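/- **Theorem (Dicke bootstrap).** Let $n\ge 0$ be an integer, $j=n/2$, and let $\mathcal H_j$ be the $(2j+1)$-dimensional spin $j$ Hilbert space with orthonormal basis $|j,m\rangle$, $m=-j,\dots,j$, on which $g\in \mathrm{SU}(2)$ acts by the Wigner rotation operator $D^j(g)$. For $0\le k\le 2j$ and $-k\le q\le k$ let $$T^k_q=\sqrt{\tfrac{2k+1}{2j+1}}\sum_{m=-j}^{j} C^{\,j\,m+q}_{k\,q,\,j\,m}\;|j,m+q\rangle\langle j,m|$$ be the spherical tensors, where $C^{\,j\,m+q}_{k\,q,\,j\,m}$ are the Clebsch–Gordan coefficients. A code $\mathcal C$ satisfies the Knill–Laflamme (KL) condition for an operator $E$ if there is a constant $c$ with $\langle u|E|v\rangle=c\,\langle u|v\rangle$ for all $u,v\in\mathcal C$. A $((j,K,d))$ spin code is a $K$-dimensional subspace of $\mathcal H_j$ that satisfies the KL conditions for all spherical tensors $T^k_q$ of rank $k<d$. An $((n,K,d))$ multiqubit code is a $K$-dimensional subspace of $(\mathbb C^2)^{\otimes n}$ that satisfies the KL conditions for all $n$-qubit Pauli errors of weight less than $d$; it is permutationally invariant if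 each codeword is fixed by all permutations of the $n$ qubits. Let $|D^n_w\rangle$ be the Dicke state, the normalized uniform superposition of the $\binom nw$ computational basis states of Hamming weight $w$, and let $\mathscr D:\mathcal H_j\to(\mathbb C^2)^{\otimes n}$ be the linear map with $\mathscr D|j,m\rangle=|D^{2j}_{j-m}\rangle$. Let $G\subset\mathrm{SU}(2)$ be a finite subgroup, $\lambda$ an irreducible representation of $G$ on $\mathbb C^K$, and let $\mathcal C\subset\mathcal H_j$ be a $((j,K,d))$ spin code that is $G$-covariant: there is an isometric encoding map $V:\mathbb C^K\to\mathcal H_j$ with image $\mathcal C$ such that $D^j(g)V=V\lambda(g)$ for all $g\in G$, that is, $D^j(g)$ implements the logical gate $\lambda(g)$. Then $\mathscr D(\mathcal C)$ is a permutationally invariant $((n,K,d))$ multiqubit code, $n=2j$. Moreover it is $G$-transversal with the same logical gates: $W=\mathscr D V$ is an isometric encoding map with image $\mathscr D(\mathcal C)$, and for each $g\in G$ the logical gate $\lambda(g)$ is implemented by a tensor product of single-qubit unitaries, namely $g^{\otimes n}W=W\lambda(g)$. -/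

import Mathlib

/-!
Conventions. A spin `j` (a nonnegative half-integer) is recorded by the natural number `n = 2 * j`.
The basis ket `|j, m⟩`, `m = j, j - 1, …, -j`, has index `a = j - m ∈ {0, …, n}`.
An `n`-qubit computational basis ket is indexed by a bit string `x : Fin n → Fin 2`.
-/

namespace DickeBootstrap

open scoped Nat InnerProductSpace

noncomputable section

/-! ### Hilbert spaces and encodings -/

/-- The `2j + 1` dimensional Hilbert space of a spin `j = n / 2` system. -/
abbrev SpinSpace (n : ℕ) : Type := EuclideanSpace ℂ (Fin (n + 1))

/-- The `2 ^ n` dimensional Hilbert space of `n` qubits. -/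
abbrev QubitSpace (n : ℕ) : Type := EuclideanSpace ℂ (Fin n → Fin 2)

/-- The `K` dimensional space of logical states. -/
abbrev LogicalSpace (K : ℕ) : Type := EuclideanSpace ℂ (Fin K)

/-- The special unitary group `SU(2)`. -/
abbrev SU2 : Type := Matrix.specialUnitaryGroup (Fin 2) ℂ

/-- The magnetic quantum number `m = j - a` of the basis ket with index `a`, where `j = n / 2`. -/
def magnetic (n : ℕ) (a : Fin (n + 1)) : ℚ := (n : ℚ) / 2 - (a : ℕ)

/-- The physical operator `U` implements the logical operator `L` on the code with (isometric)
encoding map `V`, that is, `U V = V L`. -/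
def Implements {H : Type*} [NormedAddCommGroup H] [InnerProductSpace ℂ H] {K : ℕ}
    (V : LogicalSpace K →ₗᵢ[ℂ] H) (U : H →ₗ[ℂ] H) (L : LogicalSpace K →ₗ[ℂ] LogicalSpace K) :
    Prop :=
  U ∘ₗ V.toLinearMap = V.toLinearMap ∘ₗ L

/-- The Knill-Laflamme condition of a code `C` for an error operator `E`:
`⟨u| E |v⟩ = c ⟨u|v⟩` for all codewords, with `c` independent of the codewords. -/
def KnillLaflamme {H : Type*} [NormedAddCommGroup H] [InnerProductSpace ℂ H]
    (C : Submodule ℂ H) (E : H →ₗ[ℂ] H) : Prop :=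
  ∃ c : ℂ, ∀ u ∈ C, ∀ v ∈ C, ⟪u, E v⟫_ℂ = c * ⟪u, v⟫_ℂ

/-! ### Spherical tensors -/

/-- The factorial `x!`, for `x` the image of a natural number. -/
def fact (x : ℚ) : ℝ := (⌊x⌋₊ ! : ℝ)

/-- The inverse factorial `1 / x!`, with the usual convention `1 / x! = 0` at negative integers. -/
def invFact (x : ℚ) : ℝ := if 0 ≤ x then (fact x)⁻¹ else 0

/-- The Clebsch-Gordan coefficient `⟨j₁ m₁; j₂ m₂ | J M⟩` (Condon-Shortley phases), by Racah's
formula.  It is meant for half-integers `j₁, j₂, J ≥ 0` satisfying the triangle inequalities with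
`j₁ + j₂ + J` an integer, and for `m₁, m₂, M` differing from `j₁, j₂, J` by integers, with
`|m₁| ≤ j₁`, `|m₂| ≤ j₂` and `|M| ≤ J`. -/
def clebschGordan (j₁ m₁ j₂ m₂ J M : ℚ) : ℝ :=
  if M = m₁ + m₂ then
    Real.sqrt (((2 * J + 1 : ℚ) : ℝ) * fact (J + j₁ - j₂) * fact (J - j₁ + j₂) * fact (j₁ + j₂ - J)
        * invFact (j₁ + j₂ + J + 1))
      * Real.sqrt (fact (J + M) * fact (J - M) * fact (j₁ - m₁) * fact (j₁ + m₁)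
        * fact (j₂ - m₂) * fact (j₂ + m₂))
      * ∑ s ∈ Finset.range (⌊j₁ + j₂ - J⌋₊ + 1),
          (-1 : ℝ) ^ s * invFact s * invFact (j₁ + j₂ - J - s) * invFact (j₁ - m₁ - s)
            * invFact (j₂ + m₂ - s) * invFact (J - j₂ + m₁ + s) * invFact (J - j₁ - m₂ + s)
  else 0

/-- The spherical tensor
`T^k_q = √((2k+1)/(2j+1)) ∑ m, ⟨k q; j m | j (m+q)⟩ |j, m+q⟩⟨j, m|`
on spin `j = n / 2`, for rank `0 ≤ k ≤ 2j` and `-k ≤ q ≤ k`, given by its matrix elements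
`⟨j, m'| T^k_q |j, m⟩`.  The Clebsch-Gordan coefficient vanishes unless `m' = m + q`. -/
def sphericalTensor (n k : ℕ) (q : ℤ) : SpinSpace n →ₗ[ℂ] SpinSpace n :=
  Matrix.toEuclideanLin (Matrix.of fun a b : Fin (n + 1) =>
    ((Real.sqrt ((2 * (k : ℝ) + 1) / ((n : ℝ) + 1))
      * clebschGordan k q ((n : ℚ) / 2) (magnetic n b) ((n : ℚ) / 2) (magnetic n a) : ℝ) : ℂ))

/-! ### Spin codes -/

/-- `C` is a `((j, K, d))` spin code, `j = n / 2`: a `K` dimensional subspace that satisfies the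
Knill-Laflamme conditions for all spherical tensors of rank less than `d`. -/
def IsSpinCode (n K d : ℕ) (C : Submodule ℂ (SpinSpace n)) : Prop :=
  Module.finrank ℂ C = K ∧
    ∀ k : ℕ, k < d → k ≤ n → ∀ q : ℤ, |q| ≤ (k : ℤ) → KnillLaflamme C (sphericalTensor n k q)

/-- The Wigner rotation operator `D^j(g)`, `j = n / 2`, by Wigner's formula for the matrix elements
`⟨j, m'| D^j(g) |j, m⟩`, where `j - m' = a` and `j - m = b`:
`√((j+m')! (j-m')! (j+m)! (j-m)!) ∑ s, g₀₀^(j+m-s) g₁₀^s g₀₁^(m'-m+s) g₁₁^(j-m'-s)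
  / ((j+m-s)! s! (m'-m+s)! (j-m'-s)!)`.
Equivalently, `|j, m⟩` is the polynomial `X^(j+m) Y^(j-m) / √((j+m)! (j-m)!)` and `g` acts by
`X ↦ g₀₀ X + g₁₀ Y`, `Y ↦ g₀₁ X + g₁₁ Y`.  The factorials are written below with
binomial coefficients, which vanish for the inadmissible `s`. -/
def wignerD (n : ℕ) (g : SU2) : SpinSpace n →ₗ[ℂ] SpinSpace n :=
  Matrix.toEuclideanLin (Matrix.of fun a b : Fin (n + 1) =>
    ((Real.sqrt (((a : ℕ)! * (n - (a : ℕ))! : ℝ) / ((b : ℕ)! * (n - (b : ℕ))! : ℝ)) : ℝ) : ℂ)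
      * ∑ s ∈ Finset.range ((a : ℕ) + 1),
          ((n - (b : ℕ)).choose s : ℂ) * ((b : ℕ).choose ((a : ℕ) - s) : ℂ)
            * g.1 0 0 ^ (n - (b : ℕ) - s) * g.1 1 0 ^ s
            * g.1 0 1 ^ ((b : ℕ) - ((a : ℕ) - s)) * g.1 1 1 ^ ((a : ℕ) - s))

/-- The spin `n / 2` code with encoding map `V` is `G`-covariant and transforms in the irreducible
representation `ρ`: each `D^j(g)`, `g ∈ G`, implements the logical gate `ρ g`. -/
def IsCovariant {n K : ℕ} (G : Subgroup SU2) (ρ : Representation ℂ G (LogicalSpace K))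
    (V : LogicalSpace K →ₗᵢ[ℂ] SpinSpace n) : Prop :=
  ρ.IsIrreducible ∧ ∀ g : G, Implements V (wignerD n (g : SU2)) (ρ g)

/-! ### Multiqubit codes -/

/-- The tensor product `A₁ ⊗ ⋯ ⊗ Aₙ` of single-qubit operators. -/
def tensorOp {n : ℕ} (A : Fin n → Matrix (Fin 2) (Fin 2) ℂ) : QubitSpace n →ₗ[ℂ] QubitSpace n :=
  Matrix.toEuclideanLin (Matrix.of fun x y : Fin n → Fin 2 => ∏ i, A i (x i) (y i))

/-- Labels of the single-qubit Pauli operators. -/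
inductive Pauli : Type
  | I
  | X
  | Y
  | Z
  deriving DecidableEq

/-- The Pauli matrices. -/
def Pauli.toMatrix : Pauli → Matrix (Fin 2) (Fin 2) ℂ
  | .I => 1
  | .X => !![0, 1; 1, 0]
  | .Y => !![0, -Complex.I; Complex.I, 0]
  | .Z => !![1, 0; 0, -1]

/-- The weight of an `n`-qubit Pauli error: the number of its nontrivial tensor factors. -/
def pauliWeight {n : ℕ} (E : Fin n → Pauli) : ℕ := (Finset.univ.filter fun i => E i ≠ .I).card

/-- The `n`-qubit Pauli error `E₁ ⊗ ⋯ ⊗ Eₙ`. -/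
def pauliOp {n : ℕ} (E : Fin n → Pauli) : QubitSpace n →ₗ[ℂ] QubitSpace n :=
  tensorOp fun i => (E i).toMatrix

/-- `C` is an `((n, K, d))` multiqubit code: a `K` dimensional subspace of the space of `n` qubits
that satisfies the Knill-Laflamme conditions for all Pauli errors of weight less than `d`. -/
def IsQubitCode (n K d : ℕ) (C : Submodule ℂ (QubitSpace n)) : Prop :=
  Module.finrank ℂ C = K ∧
    ∀ E : Fin n → Pauli, pauliWeight E < d → KnillLaflamme C (pauliOp E)

/-- Every codeword is fixed by all permutations of the qubits. -/
def IsPermutationInvariant {n : ℕ} (C : Submodule ℂ (QubitSpace n)) : Prop :=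
  ∀ ψ ∈ C, ∀ σ : Equiv.Perm (Fin n), ∀ x : Fin n → Fin 2, ψ (x ∘ σ) = ψ x

/-- The multiqubit code with encoding map `W` is `G`-transversal, with logical gates `ρ`: each
logical gate `ρ g` is implemented by some tensor product of single-qubit unitaries. -/
def IsTransversal {n K : ℕ} (G : Subgroup SU2) (ρ : Representation ℂ G (LogicalSpace K))
    (W : LogicalSpace K →ₗᵢ[ℂ] QubitSpace n) : Prop :=
  ∀ g : G, ∃ U : Fin n → Matrix.unitaryGroup (Fin 2) ℂ,
    Implements W (tensorOp fun i => (U i : Matrix (Fin 2) (Fin 2) ℂ)) (ρ g)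

/-! ### The Dicke state mapping -/

/-- The Hamming weight of a bit string. -/
def bitWeight {n : ℕ} (x : Fin n → Fin 2) : ℕ := (Finset.univ.filter fun i => x i = 1).card

/-- The Dicke state `|D^n_w⟩`: the normalized uniform superposition of the `n.choose w` basis
kets of Hamming weight `w`. -/
def dickeState (n w : ℕ) : QubitSpace n :=
  WithLp.toLp 2 fun x => if bitWeight x = w then ((Real.sqrt (n.choose w))⁻¹ : ℂ) else 0

/-- The Dicke state mapping: the linear map with `|j, m⟩ ↦ |D^{2j}_{j-m}⟩`, `j = n / 2`. -/
def dickeMap (n : ℕ) : SpinSpace n →ₗ[ℂ] QubitSpace n :=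
  ∑ a : Fin (n + 1), (EuclideanSpace.projₗ a : SpinSpace n →ₗ[ℂ] ℂ).smulRight (dickeState n a)

end

end DickeBootstrap

/-!
The Dicke state mapping `𝒟` is an isometry onto the symmetric subspace which intertwines the spin
`n / 2` representation with `g ↦ g^{⊗ n}` (`inner_dickeMap`, `tensorOp_dickeMap`).  So dimension,
permutation invariance and the logical gates carry over to `𝒟(C)` at once, and what remains is the
Knill-Laflamme condition for a Pauli error `E` of weight `w < d`.

That condition for `E` on `𝒟(C)` is the one for `𝒟† E 𝒟` on `C`.  As the operators satisfying the
condition form a subspace, it is enough that `𝒟† E 𝒟` lies in the span of the spherical tensors of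
rank at most `w`.  This is shown with explicit matrix elements, without representation theory.

* The operator `𝒟† E 𝒟` is a combination of the operators `B_w(x, y)`
  (`matrixUnitCompression n w x y`, `x, y ≤ w`), the compressions of products of `w` matrix units and
  `n - w` identities (`compressionMatrix_mem`).  Its matrix elements are read off from the generating
  polynomial `∏ i, ∑ s t, ⟨s|Eᵢ|t⟩ X^s Y^t`, in which an identity contributes `1 + X Y`.
* By Racah's formula, `T^w_q` is a combination of the `B_w(x, y)` with `x, y ≤ w` and `y = x + q`,
  and the coefficient of `B_w(x, y)` is `(-1)^y` times a nonzero number of a sign that is the same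
  for all of them (`sphericalTensor_eq_sum`).
* By Pascal's rule, `B_{w-1}(x, y) = B_w(x, y) + B_w(x + 1, y + 1)`.  Modulo the span of the
  `B_{w-1}`, the operators `(-1)^y B_w(x, y)` with `y = x + q` therefore all agree, so `T^w_q` is a
  nonzero multiple of each of them, as no cancellation can occur.  By induction on `w`, the
  `B_w(x, y)` lie in the span of the spherical tensors of rank at most `w`
  (`matrixUnitCompression_mem`).
-/

namespace DickeBootstrap

open scoped Nat InnerProductSpace
open Polynomial

noncomputable section

/-! ### Generating polynomials for sums over bit strings -/

lemma coeff_C_add_C_mul_X_pow {R : Type*} [CommRing R] (α β : R) (m s : ℕ) :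
    ((C α + C β * X) ^ m).coeff s = (m.choose s : R) * α ^ (m - s) * β ^ s := by
  rw [add_comm, add_pow, finsetSum_coeff]
  have h : ∀ i ∈ Finset.range (m + 1),
      ((C β * X) ^ i * C α ^ (m - i) * ((m.choose i : ℕ) : R[X])).coeff s
        = if s = i then (m.choose i : R) * α ^ (m - i) * β ^ i else 0 := by
    intro i _
    have : (C β * X) ^ i * C α ^ (m - i) * ((m.choose i : ℕ) : R[X])
        = C ((m.choose i : R) * α ^ (m - i) * β ^ i) * X ^ i := by
      simp only [mul_pow, C_mul, C_pow, map_natCast]; ring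
    rw [this, coeff_C_mul_X_pow]
  rw [Finset.sum_congr rfl h, Finset.sum_ite_eq]
  split_ifs with hs
  · rfl
  · rw [Nat.choose_eq_zero_of_lt (by simpa using hs)]; simp

lemma sum_val_eq_bitWeight {n : ℕ} (x : Fin n → Fin 2) : ∑ i, (x i : ℕ) = bitWeight x := by
  rw [bitWeight, Finset.card_filter]
  refine Finset.sum_congr rfl fun i _ => ?_
  generalize x i = t
  fin_cases t <;> simp

lemma bitWeight_le {n : ℕ} (x : Fin n → Fin 2) : bitWeight x ≤ n :=
  (Finset.card_filter_le _ _).trans (by simp)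

/-- The sum of a product over all bit strings of weight `a` is a coefficient of the product of
linear polynomials. -/
lemma sum_bitWeight_eq_coeff {n : ℕ} (h : Fin n → Fin 2 → ℂ) (a : ℕ) :
    (∑ x : Fin n → Fin 2, if bitWeight x = a then ∏ i, h i (x i) else 0)
      = (∏ i, (C (h i 0) + C (h i 1) * X)).coeff a := by
  have h1 : ∀ i, C (h i 0) + C (h i 1) * X = ∑ t : Fin 2, C (h i t) * X ^ (t : ℕ) := by
    intro i; simp [Fin.sum_univ_two]
  simp_rw [h1]
  rw [Finset.prod_univ_sum, Fintype.piFinset_univ, finsetSum_coeff]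
  refine Finset.sum_congr rfl fun x _ => ?_
  rw [Finset.prod_mul_distrib, Finset.prod_pow_eq_pow_sum, sum_val_eq_bitWeight, ← map_prod,
    coeff_C_mul_X_pow]
  simp [eq_comm]

lemma prod_apply_eq_pow_mul_pow {n : ℕ} {M : Type*} [CommMonoid M] (y : Fin n → Fin 2)
    (f : Fin 2 → M) : ∏ i, f (y i) = f 0 ^ (n - bitWeight y) * f 1 ^ bitWeight y := by
  have h1 : ∀ i, f (y i) = if y i = 1 then f 1 else f 0 := by
    intro i
    generalize y i = t
    fin_cases t <;> simp
  simp_rw [h1]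
  rw [Finset.prod_ite, Finset.prod_const, Finset.prod_const, mul_comm]
  congr 2
  have := Finset.card_filter_add_card_filter_not (s := (Finset.univ : Finset (Fin n)))
    (fun i => y i = 1)
  simp only [Finset.card_univ, Fintype.card_fin] at this
  unfold bitWeight
  omega

lemma sum_bitWeight_eq_choose (n a : ℕ) :
    (∑ x : Fin n → Fin 2, if bitWeight x = a then (1 : ℂ) else 0) = n.choose a := by
  have := sum_bitWeight_eq_coeff (n := n) (fun _ _ => (1 : ℂ)) a
  simp only [Finset.prod_const, coeff_C_add_C_mul_X_pow] at this
  simpa using this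

/-- The two-variable analogue of `sum_bitWeight_eq_coeff`: a double sum over bit strings of
weights `a` and `b` is a coefficient of a product of bilinear polynomials. -/
lemma sum_sum_bitWeight_eq_coeff {n : ℕ} (A : Fin n → Matrix (Fin 2) (Fin 2) ℂ) (a b : ℕ) :
    (∑ x : Fin n → Fin 2, if bitWeight x = a then
        ∑ y : Fin n → Fin 2, if bitWeight y = b then ∏ i, A i (x i) (y i) else 0 else 0)
      = ((∏ i, ∑ t : Fin 2 × Fin 2,
          C (C (A i t.1 t.2) * X ^ (t.1 : ℕ)) * X ^ (t.2 : ℕ) : ℂ[X][X]).coeff b).coeff a := by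
  rw [Finset.prod_univ_sum, Fintype.piFinset_univ, finsetSum_coeff, finsetSum_coeff]
  have h1 : ∀ x : Fin n → Fin 2, (if bitWeight x = a then
        ∑ y : Fin n → Fin 2, if bitWeight y = b then ∏ i, A i (x i) (y i) else 0 else 0)
      = ∑ y : Fin n → Fin 2, if bitWeight x = a ∧ bitWeight y = b then
          ∏ i, A i (x i) (y i) else 0 := by
    intro x
    by_cases hx : bitWeight x = a <;> simp [hx]
  simp_rw [h1]
  rw [← Fintype.sum_prod_type', ← (Equiv.arrowProdEquivProdArrow (Fin n) (fun _ => Fin 2)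
    (fun _ => Fin 2)).sum_comp]
  refine Finset.sum_congr rfl fun f _ => ?_
  rw [Finset.prod_mul_distrib, Finset.prod_pow_eq_pow_sum, ← map_prod, Finset.prod_mul_distrib,
    Finset.prod_pow_eq_pow_sum, ← map_prod,
    sum_val_eq_bitWeight (fun i => (f i).1), sum_val_eq_bitWeight (fun i => (f i).2),
    coeff_C_mul_X_pow]
  change (if bitWeight (fun i => (f i).1) = a ∧ bitWeight (fun i => (f i).2) = b then
    ∏ i, A i (f i).1 (f i).2 else 0) = _
  by_cases hb : b = bitWeight (fun i => (f i).2)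
  · rw [if_pos hb, coeff_C_mul_X_pow]
    simp [hb, eq_comm]
  · rw [if_neg hb, if_neg (fun h => hb h.2.symm)]; simp

/-- The coefficients of `x^p y^q (1 + x y)^m`. -/
lemma coeff_coeff_monomial_mul_one_add_pow (m p q a b : ℕ) (c : ℂ) :
    (((C (C c * X ^ p) * X ^ q * (1 + C X * X) ^ m : ℂ[X][X])).coeff b).coeff a
      = c * if a + q = b + p ∧ q ≤ b then (m.choose (b - q) : ℂ) else 0 := by
  rw [mul_assoc, coeff_C_mul, mul_comm (X ^ q), coeff_mul_X_pow',
    show (1 : ℂ[X][X]) = C 1 by simp, mul_assoc, coeff_C_mul]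
  split_ifs with h1 h2 h2
  · rw [coeff_C_add_C_mul_X_pow, one_pow, mul_one, mul_comm ((_ : ℕ) : ℂ[X]), ← mul_assoc,
      ← pow_add, ← C_eq_natCast, coeff_mul_C, coeff_X_pow, if_pos (by omega), one_mul]
  · rw [coeff_C_add_C_mul_X_pow, one_pow, mul_one, mul_comm ((_ : ℕ) : ℂ[X]), ← mul_assoc,
      ← pow_add, ← C_eq_natCast, coeff_mul_C, coeff_X_pow, if_neg (by omega), zero_mul]
  · exact absurd h2.2 h1
  · simp

/-! ### The Dicke state mapping -/

lemma choose_ne_zero_of_fin {n : ℕ} (a : Fin (n + 1)) : n.choose a ≠ 0 :=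
  (Nat.choose_pos (Nat.lt_succ_iff.mp a.2)).ne'

lemma sqrt_choose_pos {n : ℕ} (a : Fin (n + 1)) : 0 < Real.sqrt (n.choose a) :=
  Real.sqrt_pos.mpr (by exact_mod_cast Nat.choose_pos (Nat.lt_succ_iff.mp a.2))

lemma sqrt_choose_mul_self (n a : ℕ) :
    (Real.sqrt (n.choose a) : ℂ) * (Real.sqrt (n.choose a) : ℂ) = n.choose a := by
  rw [← Complex.ofReal_mul, Real.mul_self_sqrt (by positivity)]; simp

lemma dickeMap_apply {n : ℕ} (v : SpinSpace n) (x : Fin n → Fin 2) :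
    dickeMap n v x = v ⟨bitWeight x, Nat.lt_succ_iff.mpr (bitWeight_le x)⟩
      * (Real.sqrt (n.choose (bitWeight x)) : ℂ)⁻¹ := by
  have : dickeMap n v x = ∑ a : Fin (n + 1), v a * dickeState n a x := by
    simp [dickeMap]
  rw [this, Finset.sum_eq_single ⟨bitWeight x, Nat.lt_succ_iff.mpr (bitWeight_le x)⟩]
  · simp [dickeState]
  · intro a _ ha
    have : bitWeight x ≠ a := fun h => ha (Fin.ext h.symm)
    simp [dickeState, this]
  · simp

lemma sum_eq_sum_sum_bitWeight {n : ℕ} (F : (Fin n → Fin 2) → ℂ) :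
    ∑ x, F x = ∑ a : Fin (n + 1), ∑ x : Fin n → Fin 2, if bitWeight x = a then F x else 0 := by
  rw [Finset.sum_comm]
  refine Finset.sum_congr rfl fun x _ => ?_
  rw [Finset.sum_eq_single ⟨bitWeight x, Nat.lt_succ_iff.mpr (bitWeight_le x)⟩]
  · simp
  · intro a _ ha
    exact if_neg fun h => ha (Fin.ext h.symm)
  · simp

lemma inner_dickeMap {n : ℕ} (u v : SpinSpace n) :
    ⟪dickeMap n u, dickeMap n v⟫_ℂ = ⟪u, v⟫_ℂ := by
  rw [PiLp.inner_apply, PiLp.inner_apply, sum_eq_sum_sum_bitWeight]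
  refine Finset.sum_congr rfl fun a _ => ?_
  have h1 : ∀ x : Fin n → Fin 2,
      (if bitWeight x = a then ⟪dickeMap n u x, dickeMap n v x⟫_ℂ else 0)
        = (⟪u a, v a⟫_ℂ * (n.choose a : ℂ)⁻¹) * if bitWeight x = a then (1 : ℂ) else 0 := by
    intro x
    by_cases hx : bitWeight x = a
    · have hx' : (⟨bitWeight x, Nat.lt_succ_iff.mpr (bitWeight_le x)⟩ : Fin (n + 1)) = a :=
        Fin.ext hx
      rw [if_pos hx, if_pos hx, dickeMap_apply, dickeMap_apply, hx', hx,
        ← sqrt_choose_mul_self n a]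
      simp only [RCLike.inner_apply, map_mul, map_inv₀, Complex.conj_ofReal, mul_inv]
      ring
    · simp [hx]
  simp_rw [h1]
  rw [← Finset.mul_sum, sum_bitWeight_eq_choose, mul_assoc,
    inv_mul_cancel₀ (by exact_mod_cast choose_ne_zero_of_fin a), mul_one]

/-- The Dicke state mapping as a linear isometry. -/
def dickeIsometry (n : ℕ) : SpinSpace n →ₗᵢ[ℂ] QubitSpace n :=
  (dickeMap n).isometryOfInner inner_dickeMap

lemma tensorOp_dickeMap_apply {n : ℕ} (A : Fin n → Matrix (Fin 2) (Fin 2) ℂ) (v : SpinSpace n)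
    (x : Fin n → Fin 2) :
    tensorOp A (dickeMap n v) x = ∑ b : Fin (n + 1),
      (∑ y : Fin n → Fin 2, if bitWeight y = b then ∏ i, A i (x i) (y i) else 0)
        * (v b * (Real.sqrt (n.choose b) : ℂ)⁻¹) := by
  have h : tensorOp A (dickeMap n v) x
      = ∑ y : Fin n → Fin 2, (∏ i, A i (x i) (y i)) * dickeMap n v y := by
    simp [tensorOp, Matrix.toLpLin_apply, Matrix.mulVec, dotProduct]
  rw [h, sum_eq_sum_sum_bitWeight]
  refine Finset.sum_congr rfl fun b _ => ?_
  rw [Finset.sum_mul]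
  refine Finset.sum_congr rfl fun y _ => ?_
  by_cases hy : bitWeight y = b
  · have hy' : (⟨bitWeight y, Nat.lt_succ_iff.mpr (bitWeight_le y)⟩ : Fin (n + 1)) = b :=
      Fin.ext hy
    rw [if_pos hy, if_pos hy, dickeMap_apply, hy', hy]
  · simp [hy]

/-- The matrix of `𝒟† (A₁ ⊗ ⋯ ⊗ Aₙ) 𝒟`, the compression of a product operator along the Dicke state
mapping. -/
def compressionMatrix {n : ℕ} (A : Fin n → Matrix (Fin 2) (Fin 2) ℂ) :
    Matrix (Fin (n + 1)) (Fin (n + 1)) ℂ :=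
  Matrix.of fun a b =>
    (∑ x : Fin n → Fin 2, if bitWeight x = a then
      ∑ y : Fin n → Fin 2, if bitWeight y = b then ∏ i, A i (x i) (y i) else 0 else 0)
    * ((Real.sqrt (n.choose a) : ℂ)⁻¹ * (Real.sqrt (n.choose b) : ℂ)⁻¹)

lemma inner_dickeMap_tensorOp {n : ℕ} (A : Fin n → Matrix (Fin 2) (Fin 2) ℂ) (u v : SpinSpace n) :
    ⟪dickeMap n u, tensorOp A (dickeMap n v)⟫_ℂ
      = ⟪u, Matrix.toEuclideanLin (compressionMatrix A) v⟫_ℂ := by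
  rw [PiLp.inner_apply, PiLp.inner_apply, sum_eq_sum_sum_bitWeight]
  refine Finset.sum_congr rfl fun a _ => ?_
  have h : Matrix.toEuclideanLin (compressionMatrix A) v a
      = ∑ b, compressionMatrix A a b * v b := by
    simp [Matrix.toLpLin_apply, Matrix.mulVec, dotProduct]
  simp only [RCLike.inner_apply]
  rw [h, Finset.sum_mul]
  simp only [compressionMatrix, Matrix.of_apply, Finset.sum_mul]
  rw [Finset.sum_comm]
  refine Finset.sum_congr rfl fun x _ => ?_
  by_cases hx : bitWeight x = a
  · have hx' : (⟨bitWeight x, Nat.lt_succ_iff.mpr (bitWeight_le x)⟩ : Fin (n + 1)) = a :=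
      Fin.ext hx
    rw [if_pos hx, tensorOp_dickeMap_apply, Finset.sum_mul]
    refine Finset.sum_congr rfl fun b _ => ?_
    rw [if_pos hx, dickeMap_apply, hx', hx]
    simp only [map_mul, map_inv₀, Complex.conj_ofReal]
    ring
  · simp [hx]

/-! ### Wigner rotation operators -/

/-- The sum in Wigner's formula for `⟨j, m'| D^j(M) |j, m⟩`, with `a = j - m'` and `b = j - m`. -/
def wignerSum (n : ℕ) (M : Matrix (Fin 2) (Fin 2) ℂ) (a b : ℕ) : ℂ :=
  ∑ s ∈ Finset.range (a + 1),
    ((n - b).choose s : ℂ) * (b.choose (a - s) : ℂ)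
      * M 0 0 ^ (n - b - s) * M 1 0 ^ s * M 0 1 ^ (b - (a - s)) * M 1 1 ^ (a - s)

lemma sum_bitWeight_prod_eq_wignerSum {n : ℕ} (M : Matrix (Fin 2) (Fin 2) ℂ) (y : Fin n → Fin 2)
    (a : ℕ) :
    (∑ x : Fin n → Fin 2, if bitWeight x = a then ∏ i, M (x i) (y i) else 0)
      = wignerSum n M a (bitWeight y) := by
  rw [sum_bitWeight_eq_coeff (fun i t => M t (y i))]
  rw [prod_apply_eq_pow_mul_pow y (fun t => C (M 0 t) + C (M 1 t) * X), coeff_mul,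
    Finset.Nat.sum_antidiagonal_eq_sum_range_succ_mk, wignerSum]
  refine Finset.sum_congr rfl fun s _ => ?_
  rw [coeff_C_add_C_mul_X_pow, coeff_C_add_C_mul_X_pow]
  ring

/-- Both sides are the sum of `∏ i, M (x i) (y i)` over all bit strings `x` of weight `a` and `y` of
weight `b`, in the two orders of summation. -/
lemma choose_mul_wignerSum_transpose (n : ℕ) (M : Matrix (Fin 2) (Fin 2) ℂ) (a b : ℕ) :
    (n.choose a : ℂ) * wignerSum n M.transpose b a = n.choose b * wignerSum n M a b := by
  have hl : ∀ x : Fin n → Fin 2,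
      (if bitWeight x = a then (1 : ℂ) else 0) * wignerSum n M.transpose b a
      = ∑ y : Fin n → Fin 2, if bitWeight y = b then
          (if bitWeight x = a then ∏ i, M (x i) (y i) else 0) else 0 := by
    intro x
    by_cases hx : bitWeight x = a
    · simp only [hx, if_true, one_mul]
      rw [← hx, ← sum_bitWeight_prod_eq_wignerSum]
      rfl
    · simp [hx]
  have hr : ∀ y : Fin n → Fin 2, (if bitWeight y = b then (1 : ℂ) else 0) * wignerSum n M a b
      = ∑ x : Fin n → Fin 2, if bitWeight y = b then
          (if bitWeight x = a then ∏ i, M (x i) (y i) else 0) else 0 := by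
    intro y
    by_cases hy : bitWeight y = b
    · simp only [hy, if_true, one_mul]
      rw [← hy, ← sum_bitWeight_prod_eq_wignerSum]
    · simp [hy]
  rw [← sum_bitWeight_eq_choose, ← sum_bitWeight_eq_choose, Finset.sum_mul, Finset.sum_mul,
    Finset.sum_congr rfl fun x _ => hl x, Finset.sum_congr rfl fun y _ => hr y, Finset.sum_comm]

lemma sqrt_factorial_ratio {n : ℕ} (a b : Fin (n + 1)) :
    Real.sqrt (((a : ℕ)! * (n - (a : ℕ))! : ℝ) / ((b : ℕ)! * (n - (b : ℕ))! : ℝ))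
      = Real.sqrt (n.choose b) / Real.sqrt (n.choose a) := by
  rw [← Real.sqrt_div (by positivity), Nat.cast_choose ℝ (Nat.lt_succ_iff.mp a.2),
    Nat.cast_choose ℝ (Nat.lt_succ_iff.mp b.2)]
  congr 1
  have := Nat.factorial_ne_zero
  field_simp

/-- The Dicke state mapping intertwines the spin `n / 2` representation with `g ↦ g^{⊗ n}`. -/
theorem tensorOp_dickeMap {n : ℕ} (g : SU2) (v : SpinSpace n) :
    tensorOp (fun _ => g.1) (dickeMap n v) = dickeMap n (wignerD n g v) := by
  ext x
  rw [tensorOp_dickeMap_apply, dickeMap_apply]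
  obtain ⟨a, ha⟩ : ∃ a : Fin (n + 1), a = ⟨bitWeight x, Nat.lt_succ_iff.mpr (bitWeight_le x)⟩ :=
    ⟨_, rfl⟩
  have ha' : bitWeight x = a := by rw [ha]
  have hw : wignerD n g v a = ∑ b : Fin (n + 1),
      ((Real.sqrt (n.choose b) / Real.sqrt (n.choose a) : ℝ) : ℂ) * wignerSum n g.1 a b * v b := by
    simp only [wignerD, Matrix.toLpLin_apply, Matrix.mulVec, dotProduct, Matrix.of_apply,
      PiLp.toLp_apply, sqrt_factorial_ratio, wignerSum]
  rw [← ha, ha', hw, Finset.sum_mul]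
  refine Finset.sum_congr rfl fun b _ => ?_
  have h1 : (∑ y : Fin n → Fin 2, if bitWeight y = b then ∏ i, g.1 (x i) (y i) else 0)
      = wignerSum n g.1.transpose b a := by
    rw [← ha', ← sum_bitWeight_prod_eq_wignerSum]
    rfl
  have h2 := choose_mul_wignerSum_transpose n g.1 a b
  rw [h1]
  rw [← sqrt_choose_mul_self n a, ← sqrt_choose_mul_self n b] at h2
  have hsa : (Real.sqrt (n.choose a) : ℂ) ≠ 0 := by exact_mod_cast (sqrt_choose_pos a).ne'
  have hsb : (Real.sqrt (n.choose b) : ℂ) ≠ 0 := by exact_mod_cast (sqrt_choose_pos b).ne'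
  push_cast
  field_simp
  linear_combination v b * h2

/-! ### Compressed matrix units -/

/-- The compression to the symmetric subspace of a tensor product of `w` matrix units `|s⟩⟨t|` and
`n - w` identities, where `x` of the `s` and `y` of the `t` are equal to `1`.  It shifts the index
of a basis ket by `x - y`. -/
def matrixUnitCompression (n w x y : ℕ) : SpinSpace n →ₗ[ℂ] SpinSpace n :=
  Matrix.toEuclideanLin (Matrix.of fun a b : Fin (n + 1) =>
    (if (a : ℕ) + y = b + x ∧ y ≤ (b : ℕ) then ((n - w).choose (b - y) : ℂ) else 0)
      * ((Real.sqrt (n.choose a) : ℂ)⁻¹ * (Real.sqrt (n.choose b) : ℂ)⁻¹))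

/-- One identity factor is resolved as `|0⟩⟨0| + |1⟩⟨1|`. -/
lemma matrixUnitCompression_succ {n w : ℕ} (hw : w + 1 ≤ n) (x y : ℕ) :
    matrixUnitCompression n w x y
      = matrixUnitCompression n (w + 1) x y + matrixUnitCompression n (w + 1) (x + 1) (y + 1) := by
  unfold matrixUnitCompression
  rw [← map_add]
  congr 1
  ext a b
  simp only [Matrix.of_apply, Matrix.add_apply]
  rw [← add_mul]
  congr 1
  by_cases h : (a : ℕ) + y = b + x
  · have h' : (a : ℕ) + (y + 1) = b + (x + 1) := by omega
    simp only [h, h', true_and]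
    rcases lt_trichotomy y (b : ℕ) with hy | hy | hy
    · obtain ⟨t, ht⟩ : ∃ t, (b : ℕ) - y = t + 1 := ⟨b - y - 1, by omega⟩
      have ht' : (b : ℕ) - (y + 1) = t := by omega
      have hn : n - w = (n - (w + 1)) + 1 := by omega
      rw [if_pos hy.le, if_pos hy.le, if_pos (Nat.succ_le_of_lt hy), ht, ht', hn,
        Nat.choose_succ_succ]
      push_cast
      ring
    · simp [hy]
    · rw [if_neg (by omega), if_neg (by omega), if_neg (by omega)]; simp
  · have h' : ¬ (a : ℕ) + (y + 1) = b + (x + 1) := by omega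
    simp [h, h']

/-! ### Racah's formula -/

lemma fact_natCast {z : ℚ} {m : ℕ} (h : z = m) : fact z = m ! := by
  simp [fact, h]

lemma invFact_natCast {z : ℚ} {m : ℕ} (h : z = m) : invFact z = (m ! : ℝ)⁻¹ := by
  rw [invFact, if_pos (by rw [h]; positivity), fact_natCast h]

lemma invFact_of_neg {z : ℚ} (h : z < 0) : invFact z = 0 := if_neg (not_le.mpr h)

/-- The factorials of Racah's formula that depend on the two kets form a binomial coefficient. -/
lemma invFact_mul_invFact {n k b y : ℕ} (hk : k ≤ n) :
    invFact ((n : ℚ) - b - (k - y)) * invFact ((b : ℚ) - y)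
      = (if y ≤ b then ((n - k).choose (b - y) : ℝ) else 0) * ((n - k)! : ℝ)⁻¹ := by
  by_cases h1 : y ≤ b
  · rw [if_pos h1, invFact_natCast (z := (b : ℚ) - y) (m := b - y) (by push_cast [h1]; ring)]
    by_cases h2 : b - y ≤ n - k
    · rw [invFact_natCast (m := (n - k) - (b - y)) (by push_cast [h2, hk, h1]; ring),
        Nat.cast_choose ℝ h2]
      have := Nat.factorial_ne_zero
      field_simp
    · have h3 : (n : ℚ) + y < b + k := by exact_mod_cast (by omega : n + y < b + k)
      rw [invFact_of_neg (z := (n : ℚ) - b - (k - y)) (by linarith),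
        Nat.choose_eq_zero_of_lt (by omega)]
      simp
  · rw [if_neg h1, invFact_of_neg (z := (b : ℚ) - y)]
    · simp
    · have : (b : ℚ) < y := by exact_mod_cast (by omega : b < y)
      linarith

/-- The part of the coefficients of `sphericalTensor_eq_sum` common to all terms. -/
def sphericalNorm (n k : ℕ) (q : ℤ) : ℝ :=
  Real.sqrt ((2 * (k : ℝ) + 1) / ((n : ℝ) + 1))
    * Real.sqrt (((n : ℝ) + 1) * k ! * (n - k)! * k ! * ((k + n + 1)! : ℝ)⁻¹)
    * Real.sqrt (fact (k - q) * fact (k + q)) * n ! * ((n - k)! : ℝ)⁻¹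

lemma sphericalNorm_pos (n k : ℕ) (q : ℤ) : 0 < sphericalNorm n k q := by
  unfold sphericalNorm fact
  positivity

/-- The weight of a compressed matrix unit in a spherical tensor of rank `k`, up to sign. -/
def sphericalWeight (k x y : ℕ) : ℝ :=
  (y ! : ℝ)⁻¹ * ((k - y)! : ℝ)⁻¹ * (x ! : ℝ)⁻¹ * ((k - x)! : ℝ)⁻¹

lemma sphericalWeight_pos (k x y : ℕ) : 0 < sphericalWeight k x y := by
  unfold sphericalWeight
  positivity

lemma sqrt_factorial_eq {n : ℕ} (a : Fin (n + 1)) :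
    Real.sqrt ((a : ℕ)! * (n - (a : ℕ))!) = Real.sqrt (n !) * (Real.sqrt (n.choose a))⁻¹ := by
  rw [← Real.sqrt_inv, ← Real.sqrt_mul (by positivity),
    Nat.cast_choose ℝ (Nat.lt_succ_iff.mp a.2)]
  congr 1
  have := Nat.factorial_ne_zero
  field_simp

/-- The matrix elements of a spherical tensor by Racah's formula, with the summation index `s`
replaced by `y = k - s` and `x = y - q`. -/
lemma clebschGordan_eq {n k : ℕ} {q : ℤ} (hk : k ≤ n) (hq : |q| ≤ (k : ℤ)) (a b : Fin (n + 1)) :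
    Real.sqrt ((2 * (k : ℝ) + 1) / ((n : ℝ) + 1))
        * clebschGordan k q ((n : ℚ) / 2) (magnetic n b) ((n : ℚ) / 2) (magnetic n a)
      = ∑ p ∈ (Finset.range (k + 1) ×ˢ Finset.range (k + 1)).filter fun p => (p.2 : ℤ) = p.1 + q,
          sphericalNorm n k q * (-1) ^ (k + p.2) * sphericalWeight k p.1 p.2
            * ((if (a : ℕ) + p.2 = b + p.1 ∧ p.2 ≤ (b : ℕ) then
                ((n - k).choose (b - p.2) : ℝ) else 0)
              * ((Real.sqrt (n.choose a))⁻¹ * (Real.sqrt (n.choose b))⁻¹)) := by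
  have hbn : (b : ℕ) ≤ n := Nat.lt_succ_iff.mp b.2
  have han : (a : ℕ) ≤ n := Nat.lt_succ_iff.mp a.2
  rw [abs_le] at hq
  unfold clebschGordan
  have hM : magnetic n a = (q : ℚ) + magnetic n b ↔ (b : ℤ) = a + q := by
    unfold magnetic
    constructor
    · intro h
      have : (b : ℚ) = a + q := by linarith
      exact_mod_cast this
    · intro h
      have : (b : ℚ) = a + q := by exact_mod_cast h
      linarith
  by_cases hab : (b : ℤ) = a + q
  swap
  · rw [if_neg (hM.not.mpr hab), mul_zero]
    refine (Finset.sum_eq_zero fun p hp => ?_).symm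
    have hp2 := (Finset.mem_filter.mp hp).2
    rw [if_neg (by omega)]
    simp
  rw [if_pos (hM.mpr hab)]
  have e1 : fact ((n : ℚ) / 2 + k - n / 2) = k ! := fact_natCast (by ring)
  have e2 : fact ((n : ℚ) / 2 - k + n / 2) = (n - k)! := fact_natCast (by push_cast [hk]; ring)
  have e3 : fact ((k : ℚ) + n / 2 - n / 2) = k ! := fact_natCast (by ring)
  have e4 : invFact ((k : ℚ) + n / 2 + n / 2 + 1) = ((k + n + 1)! : ℝ)⁻¹ :=
    invFact_natCast (by push_cast; ring)
  have e5 : fact ((n : ℚ) / 2 + magnetic n a) = (n - (a : ℕ))! :=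
    fact_natCast (by unfold magnetic; push_cast [han]; ring)
  have e6 : fact ((n : ℚ) / 2 - magnetic n a) = (a : ℕ)! :=
    fact_natCast (by unfold magnetic; ring)
  have e7 : fact ((n : ℚ) / 2 - magnetic n b) = (b : ℕ)! :=
    fact_natCast (by unfold magnetic; ring)
  have e8 : fact ((n : ℚ) / 2 + magnetic n b) = (n - (b : ℕ))! :=
    fact_natCast (by unfold magnetic; push_cast [hbn]; ring)
  have e9 : ((2 * ((n : ℚ) / 2) + 1 : ℚ) : ℝ) = (n : ℝ) + 1 := by push_cast; ring
  have e10 : ⌊(k : ℚ) + n / 2 - n / 2⌋₊ = k := by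
    rw [add_sub_cancel_right]; exact Nat.floor_natCast k
  have e11 : Real.sqrt (((n - (a : ℕ))! : ℝ) * (a : ℕ)! * fact (k - q) * fact (k + q)
        * (b : ℕ)! * (n - (b : ℕ))!)
      = Real.sqrt (fact (k - q) * fact (k + q)) * n !
        * ((Real.sqrt (n.choose a))⁻¹ * (Real.sqrt (n.choose b))⁻¹) := by
    have : ((n - (a : ℕ))! : ℝ) * (a : ℕ)! * fact (k - q) * fact (k + q)
        * (b : ℕ)! * (n - (b : ℕ))! = (fact (k - q) * fact (k + q))
          * ((a : ℕ)! * (n - (a : ℕ))!) * ((b : ℕ)! * (n - (b : ℕ))!) := by ring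
    have h0 : 0 ≤ fact (k - q) * fact (k + q) := by unfold fact; positivity
    rw [this, Real.sqrt_mul (by positivity), Real.sqrt_mul h0, sqrt_factorial_eq,
      sqrt_factorial_eq]
    have := Real.mul_self_sqrt (Nat.cast_nonneg (α := ℝ) (n !))
    linear_combination (Real.sqrt (fact (k - q) * fact (k + q))
        * ((Real.sqrt (n.choose a))⁻¹ * (Real.sqrt (n.choose b))⁻¹)) * this
  rw [e1, e2, e3, e4, e5, e6, e7, e8, e9, e10, e11, Finset.sum_filter, Finset.sum_product,
    Finset.sum_comm, Finset.mul_sum, Finset.mul_sum, ← Finset.sum_range_reflect]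
  refine Finset.sum_congr rfl fun y hy => ?_
  have hyk : y ≤ k := Nat.lt_succ_iff.mp (Finset.mem_range.mp hy)
  have hs : ((k + 1 - 1 - y : ℕ) : ℚ) = k - y := by push_cast [hyk]; simp
  have f1 : invFact (((k + 1 - 1 - y : ℕ) : ℚ)) = ((k - y)! : ℝ)⁻¹ := invFact_natCast (by simp)
  have f2 : invFact ((k : ℚ) + n / 2 - n / 2 - (k + 1 - 1 - y : ℕ)) = (y ! : ℝ)⁻¹ :=
    invFact_natCast (by rw [hs]; ring)
  have f3 : ((n : ℚ) / 2 + magnetic n b - (k + 1 - 1 - y : ℕ)) = n - b - (k - y) := by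
    rw [hs]; unfold magnetic; ring
  have f4 : ((n : ℚ) / 2 - k - magnetic n b + (k + 1 - 1 - y : ℕ)) = b - y := by
    rw [hs]; unfold magnetic; ring
  have f5 := invFact_mul_invFact (b := b) (y := y) hk
  rw [f1, f2, f3, f4]
  -- If `x = y - q` is outside of `0, …, k`, there is no matching term on the right, and on the left
  -- one of the inverse factorials of `x` and `k - x` vanishes.
  by_cases hx : 0 ≤ (y : ℤ) - q ∧ (y : ℤ) - q ≤ k
  · obtain ⟨x, hxe⟩ := Int.eq_ofNat_of_zero_le hx.1
    have hxk : x ≤ k := by omega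
    have hxq : (x : ℚ) = y - q := by
      have : (x : ℤ) = y - q := by omega
      exact_mod_cast this
    have g1 : invFact ((k : ℚ) - q - (k + 1 - 1 - y : ℕ)) = (x ! : ℝ)⁻¹ :=
      invFact_natCast (by rw [hs, hxq]; ring)
    have g2 : invFact ((n : ℚ) / 2 - n / 2 + q + (k + 1 - 1 - y : ℕ)) = ((k - x)! : ℝ)⁻¹ :=
      invFact_natCast (by rw [hs, Nat.cast_sub hxk, hxq]; ring)
    have g3 : (-1 : ℝ) ^ (k + 1 - 1 - y) = (-1) ^ (k + y) := by
      obtain ⟨t, rfl⟩ := Nat.exists_eq_add_of_le hyk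
      rw [show y + t + 1 - 1 - y = t by omega, show y + t + y = t + 2 * y by ring, pow_add,
        pow_mul]
      simp
    rw [Finset.sum_eq_single x]
    · rw [if_pos (by dsimp only; omega), g1, g2, g3]
      have hc : ((a : ℕ) + y = b + x ∧ y ≤ (b : ℕ)) ↔ y ≤ (b : ℕ) := by
        constructor
        · exact fun h => h.2
        · exact fun h => ⟨by omega, h⟩
      simp only [hc]
      unfold sphericalNorm sphericalWeight
      linear_combination (Real.sqrt ((2 * (k : ℝ) + 1) / ((n : ℝ) + 1))
        * Real.sqrt (((n : ℝ) + 1) * k ! * (n - k)! * k ! * ((k + n + 1)! : ℝ)⁻¹)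
        * Real.sqrt (fact (k - q) * fact (k + q)) * n !
        * ((Real.sqrt (n.choose a))⁻¹ * (Real.sqrt (n.choose b))⁻¹) * (-1) ^ (k + y)
        * (y ! : ℝ)⁻¹ * ((k - y)! : ℝ)⁻¹ * (x ! : ℝ)⁻¹ * ((k - x)! : ℝ)⁻¹) * f5
    · intro x' _ hx'
      exact if_neg (by dsimp only; omega)
    · intro h
      exact absurd (Finset.mem_range.mpr (by omega)) h
  · rw [Finset.sum_eq_zero]
    · rcases not_and_or.mp hx with h | h
      · have : (y : ℚ) - q < 0 := by exact_mod_cast not_le.mp h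
        rw [invFact_of_neg (z := (k : ℚ) - q - (k + 1 - 1 - y : ℕ)) (by rw [hs]; linarith)]
        simp
      · have : (k : ℚ) < y - q := by exact_mod_cast not_le.mp h
        rw [invFact_of_neg (z := (n : ℚ) / 2 - n / 2 + q + (k + 1 - 1 - y : ℕ))
          (by rw [hs]; linarith)]
        simp
    · intro x hx'
      have := Finset.mem_range.mp hx'
      exact if_neg (by dsimp only; omega)

/-- A spherical tensor is an alternating combination of compressed matrix units, with nonzero
coefficients. -/
theorem sphericalTensor_eq_sum {n k : ℕ} {q : ℤ} (hk : k ≤ n) (hq : |q| ≤ (k : ℤ)) :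
    sphericalTensor n k q
      = ∑ p ∈ (Finset.range (k + 1) ×ˢ Finset.range (k + 1)).filter fun p => (p.2 : ℤ) = p.1 + q,
          ((sphericalNorm n k q * (-1) ^ (k + p.2) * sphericalWeight k p.1 p.2 : ℝ) : ℂ)
            • matrixUnitCompression n k p.1 p.2 := by
  unfold sphericalTensor matrixUnitCompression
  simp_rw [← map_smul]
  rw [← map_sum]
  congr 1
  ext a b
  rw [Matrix.of_apply, clebschGordan_eq hk hq, Matrix.sum_apply, Complex.ofReal_sum]
  refine Finset.sum_congr rfl fun p _ => ?_
  rw [Matrix.smul_apply, Matrix.of_apply, smul_eq_mul, Complex.ofReal_mul]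
  congr 1
  split_ifs <;> simp

/-! ### Compressed matrix units in terms of spherical tensors -/

variable {n : ℕ} {S : Submodule ℂ (SpinSpace n →ₗ[ℂ] SpinSpace n)}

/-- If resolving an identity factor stays in `S`, then modulo `S` the compressed matrix units with
a given index shift agree up to alternating signs. -/
lemma alternating_matrixUnitCompression_mem {w : ℕ}
    (hS : ∀ x y, x < w → y < w →
      matrixUnitCompression n w x y + matrixUnitCompression n w (x + 1) (y + 1) ∈ S)
    (t x y : ℕ) (hx : x + t ≤ w) (hy : y + t ≤ w) :
    ((-1 : ℂ) ^ (y + t)) • matrixUnitCompression n w (x + t) (y + t)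
      - ((-1 : ℂ) ^ y) • matrixUnitCompression n w x y ∈ S := by
  induction t with
  | zero => simp
  | succ t ih =>
    have h1 := ih (by omega) (by omega)
    have h2 := S.smul_mem ((-1 : ℂ) ^ (y + t)) (hS (x + t) (y + t) (by omega) (by omega))
    have h3 := S.sub_mem h1 h2
    convert h3 using 1
    rw [← add_assoc, ← add_assoc, pow_succ]
    module

lemma matrixUnitCompression_mem_of_sphericalTensor_mem {w : ℕ} (hw : w ≤ n)
    (hS : ∀ x y, x < w → y < w →
      matrixUnitCompression n w x y + matrixUnitCompression n w (x + 1) (y + 1) ∈ S)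
    (hT : ∀ q : ℤ, |q| ≤ (w : ℤ) → sphericalTensor n w q ∈ S) {x y : ℕ} (hx : x ≤ w)
    (hy : y ≤ w) : matrixUnitCompression n w x y ∈ S := by
  set F := (Finset.range (w + 1) ×ˢ Finset.range (w + 1)).filter
    fun p => (p.2 : ℤ) = p.1 + ((y : ℤ) - x) with hF
  have hq : |(y : ℤ) - x| ≤ (w : ℤ) := by rw [abs_le]; omega
  set κ := sphericalNorm n w ((y : ℤ) - x)
  have hκ : 0 < κ := sphericalNorm_pos _ _ _
  have hmem : ∀ p ∈ F, ((-1 : ℂ) ^ p.2) • matrixUnitCompression n w p.1 p.2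
      - ((-1 : ℂ) ^ y) • matrixUnitCompression n w x y ∈ S := by
    rintro ⟨x', y'⟩ hp
    simp only [hF, Finset.mem_filter, Finset.mem_product, Finset.mem_range] at hp
    obtain ⟨⟨h1, h2⟩, h3⟩ := hp
    rcases le_total x x' with h | h
    · obtain ⟨t, rfl⟩ := Nat.exists_eq_add_of_le h
      obtain rfl : y' = y + t := by omega
      exact alternating_matrixUnitCompression_mem hS t x y (by omega) (by omega)
    · obtain ⟨t, rfl⟩ := Nat.exists_eq_add_of_le h
      obtain rfl : y = y' + t := by omega
      rw [← neg_sub]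
      exact S.neg_mem (alternating_matrixUnitCompression_mem hS t x' y' (by omega) (by omega))
  have hsum := S.sum_mem fun p (hp : p ∈ F) =>
    S.smul_mem ((κ * (-1) ^ w * sphericalWeight w p.1 p.2 : ℝ) : ℂ) (hmem p hp)
  have key : ((κ * (-1) ^ w * (∑ p ∈ F, sphericalWeight w p.1 p.2) * (-1) ^ y : ℝ) : ℂ)
      • matrixUnitCompression n w x y ∈ S := by
    convert S.sub_mem (hT _ hq) hsum using 1
    rw [sphericalTensor_eq_sum hw hq, ← Finset.sum_sub_distrib, Finset.mul_sum, Finset.sum_mul,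
      Complex.ofReal_sum, Finset.sum_smul]
    refine Finset.sum_congr rfl fun p _ => ?_
    push_cast
    rw [pow_add]
    module
  -- The alternating signs cancel, so the coefficient is a sum of positive weights up to sign.
  refine (S.smul_mem_iff ?_).mp key
  have hF0 : 0 < ∑ p ∈ F, sphericalWeight w p.1 p.2 :=
    Finset.sum_pos (fun p _ => sphericalWeight_pos _ _ _) ⟨(x, y), by
      simp only [hF, Finset.mem_filter, Finset.mem_product, Finset.mem_range]; omega⟩
  have hsign : ∀ m : ℕ, (-1 : ℝ) ^ m ≠ 0 := fun m => pow_ne_zero _ (by norm_num)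
  exact_mod_cast mul_ne_zero (mul_ne_zero (mul_ne_zero hκ.ne' (hsign w)) hF0.ne') (hsign y)

/-- The compressed matrix units on `w` qubits lie in the span of the spherical tensors of rank at
most `w`. -/
theorem matrixUnitCompression_mem {w : ℕ} (hw : w ≤ n)
    (hT : ∀ k ≤ w, ∀ q : ℤ, |q| ≤ (k : ℤ) → sphericalTensor n k q ∈ S) :
    ∀ x y, x ≤ w → y ≤ w → matrixUnitCompression n w x y ∈ S := by
  induction w with
  | zero =>
    exact fun x y => matrixUnitCompression_mem_of_sphericalTensor_mem hw
      (fun _ _ h => absurd h (Nat.not_lt_zero _)) (hT 0 le_rfl)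
  | succ w ih =>
    refine fun x y => matrixUnitCompression_mem_of_sphericalTensor_mem hw (fun x y hx hy => ?_)
      (hT (w + 1) le_rfl)
    rw [← matrixUnitCompression_succ hw]
    exact ih (by omega) (fun k hk => hT k (by omega)) x y (by omega) (by omega)

/-! ### Knill-Laflamme conditions for Pauli errors -/

/-- The operators for which a code satisfies the Knill-Laflamme condition form a subspace. -/
def knillLaflammeSubmodule {H : Type*} [NormedAddCommGroup H] [InnerProductSpace ℂ H]
    (C : Submodule ℂ H) : Submodule ℂ (H →ₗ[ℂ] H) where
  carrier := {E | KnillLaflamme C E}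
  zero_mem' := ⟨0, by simp⟩
  add_mem' := by
    rintro E F ⟨c, hc⟩ ⟨d, hd⟩
    refine ⟨c + d, fun u hu v hv => ?_⟩
    rw [LinearMap.add_apply, inner_add_right, hc u hu v hv, hd u hu v hv, add_mul]
  smul_mem' := by
    rintro r E ⟨c, hc⟩
    refine ⟨r * c, fun u hu v hv => ?_⟩
    rw [LinearMap.smul_apply, inner_smul_right, hc u hu v hv, mul_assoc]

/-- The compression of a Pauli error of weight `w` is a combination of compressed matrix units
on `w` qubits. -/
lemma compressionMatrix_mem {n : ℕ} (E : Fin n → Pauli)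
    {S : Submodule ℂ (SpinSpace n →ₗ[ℂ] SpinSpace n)}
    (hS : ∀ x y, x ≤ pauliWeight E → y ≤ pauliWeight E →
      matrixUnitCompression n (pauliWeight E) x y ∈ S) :
    Matrix.toEuclideanLin (compressionMatrix fun i => (E i).toMatrix) ∈ S := by
  set w := pauliWeight E with hw
  set A : Fin n → Matrix (Fin 2) (Fin 2) ℂ := fun i => (E i).toMatrix
  set T := Finset.univ.filter fun i => E i ≠ .I with hT
  -- The bilinear polynomial of an identity factor is `1 + x y`; the other factors are expanded.
  have hI : ∀ i, E i = .I → (∑ t : Fin 2 × Fin 2,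
      C (C (A i t.1 t.2) * X ^ (t.1 : ℕ)) * X ^ (t.2 : ℕ) : ℂ[X][X]) = 1 + C X * X := by
    intro i hi
    simp [A, hi, Pauli.toMatrix, Fintype.sum_prod_type, Fin.sum_univ_two]
  have hcard : (Finset.univ.filter fun i => ¬ E i ≠ .I).card = n - w := by
    have := Finset.card_filter_add_card_filter_not (s := (Finset.univ : Finset (Fin n)))
      (fun i => E i ≠ .I)
    simp only [Finset.card_univ, Fintype.card_fin] at this
    rw [hw]
    unfold pauliWeight
    omega
  have hprod : (∏ i, ∑ t : Fin 2 × Fin 2,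
      C (C (A i t.1 t.2) * X ^ (t.1 : ℕ)) * X ^ (t.2 : ℕ) : ℂ[X][X])
      = ∑ f : T → Fin 2 × Fin 2, C (C (∏ i : T, A i (f i).1 (f i).2) * X ^ (∑ i, ((f i).1 : ℕ)))
          * X ^ (∑ i, ((f i).2 : ℕ)) * (1 + C X * X) ^ (n - w) := by
    rw [← Finset.prod_filter_mul_prod_filter_not Finset.univ (fun i => E i ≠ .I),
      Finset.prod_congr (s₁ := Finset.univ.filter fun i => ¬ E i ≠ .I) rfl fun i hi =>
        hI i (not_not.mp (Finset.mem_filter.mp hi).2), Finset.prod_const, hcard, ← hT,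
      ← Finset.sum_mul, ← Finset.prod_coe_sort T, Finset.prod_univ_sum, Fintype.piFinset_univ]
    congr 1
    refine Finset.sum_congr rfl fun f _ => ?_
    rw [Finset.prod_mul_distrib, Finset.prod_pow_eq_pow_sum, ← map_prod, Finset.prod_mul_distrib,
      Finset.prod_pow_eq_pow_sum, ← map_prod]
  have hsum : Matrix.toEuclideanLin (compressionMatrix A)
      = ∑ f : T → Fin 2 × Fin 2, (∏ i : T, A i (f i).1 (f i).2) •
          matrixUnitCompression n w (∑ i, ((f i).1 : ℕ)) (∑ i, ((f i).2 : ℕ)) := by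
    unfold matrixUnitCompression
    simp_rw [← map_smul]
    rw [← map_sum]
    congr 1
    ext a b
    rw [compressionMatrix, Matrix.of_apply, sum_sum_bitWeight_eq_coeff, hprod, finsetSum_coeff,
      finsetSum_coeff, Finset.sum_mul, Matrix.sum_apply]
    refine Finset.sum_congr rfl fun f _ => ?_
    rw [coeff_coeff_monomial_mul_one_add_pow, Matrix.smul_apply, Matrix.of_apply, smul_eq_mul,
      mul_assoc]
  have hle : ∀ f : T → Fin 2, ∑ i, (f i : ℕ) ≤ w := by
    intro f
    calc ∑ i, (f i : ℕ) ≤ ∑ _i : T, 1 := Finset.sum_le_sum fun i _ => Nat.lt_succ_iff.mp (f i).2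
      _ = w := by simp [hw, pauliWeight, hT]
  rw [hsum]
  exact S.sum_mem fun f _ => S.smul_mem _ (hS _ _ (hle fun i => (f i).1) (hle fun i => (f i).2))

lemma pauliWeight_le {n : ℕ} (E : Fin n → Pauli) : pauliWeight E ≤ n :=
  (Finset.card_filter_le _ _).trans (by simp)

theorem IsSpinCode.isQubitCode_map_dickeMap {n K d : ℕ} {C : Submodule ℂ (SpinSpace n)}
    (hC : IsSpinCode n K d C) : IsQubitCode n K d (C.map (dickeMap n)) := by
  refine ⟨?_, fun E hE => ?_⟩
  · rw [← hC.1]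
    exact (Submodule.equivMapOfInjective _ (dickeIsometry n).injective C).finrank_eq.symm
  · have hmem := compressionMatrix_mem E (S := knillLaflammeSubmodule C)
      (matrixUnitCompression_mem (pauliWeight_le E) fun k hk q hq =>
        hC.2 k (by omega) (hk.trans (pauliWeight_le E)) q hq)
    obtain ⟨c, hc⟩ := hmem
    refine ⟨c, ?_⟩
    rintro _ ⟨u, hu, rfl⟩ _ ⟨v, hv, rfl⟩
    rw [pauliOp, inner_dickeMap_tensorOp, inner_dickeMap]
    exact hc u hu v hv

lemma bitWeight_comp_perm {n : ℕ} (x : Fin n → Fin 2) (σ : Equiv.Perm (Fin n)) :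
    bitWeight (x ∘ σ) = bitWeight x := by
  rw [← sum_val_eq_bitWeight, ← sum_val_eq_bitWeight]
  exact Equiv.sum_comp σ fun i => (x i : ℕ)

lemma isPermutationInvariant_map_dickeMap {n : ℕ} (C : Submodule ℂ (SpinSpace n)) :
    IsPermutationInvariant (C.map (dickeMap n)) := by
  rintro _ ⟨v, -, rfl⟩ σ x
  simp only [dickeMap_apply, bitWeight_comp_perm]

end
end DickeBootstrap

open DickeBootstrap in
theorem theorem1 (n K d : ℕ) (G : Subgroup SU2) [Finite G]
    (ρ : Representation ℂ G (LogicalSpace K))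
    (C : Submodule ℂ (SpinSpace n)) (V : LogicalSpace K →ₗᵢ[ℂ] SpinSpace n)
    (hC : IsSpinCode n K d C) (hV : LinearMap.range V.toLinearMap = C)
    (hcov : IsCovariant G ρ V) :
    IsQubitCode n K d (C.map (dickeMap n)) ∧
      IsPermutationInvariant (C.map (dickeMap n)) ∧
      ∃ W : LogicalSpace K →ₗᵢ[ℂ] QubitSpace n,
        W.toLinearMap = dickeMap n ∘ₗ V.toLinearMap ∧
        LinearMap.range W.toLinearMap = C.map (dickeMap n) ∧
        IsTransversal G ρ W ∧
        ∀ g : G, Implements W (tensorOp fun _ => (g : SU2).1) (ρ g) := by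
  have hW : ∀ g : G, Implements ((dickeIsometry n).comp V)
      (tensorOp fun _ => (g : SU2).1) (ρ g) := by
    intro g
    refine LinearMap.ext fun v => ?_
    exact (tensorOp_dickeMap (g : SU2) (V v)).trans
      (congrArg (dickeMap n) (LinearMap.congr_fun (hcov.2 g) v))
  refine ⟨hC.isQubitCode_map_dickeMap, isPermutationInvariant_map_dickeMap C,
    (dickeIsometry n).comp V, rfl, ?_, fun g => ⟨fun _ => ⟨(g : SU2).1,
      (Matrix.mem_specialUnitaryGroup_iff.mp (g : SU2).2).1⟩, hW g⟩, hW⟩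
  rw [← hV, ← LinearMap.range_comp]
  rfl
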